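/- Let $R$ be an integral domain with quotient field $K$. For a nonzero fractional ideal $I$ of $R$ put $I^{-1}=\{x\in K: xI\subseteq R\}$, $I_v=(I^{-1})^{-1}$ and $I_t=\bigcup\{J_v : J\subseteq I \text{ a nonzero finitely generated fractional ideal}\}$. Call $I$ a $t$-ideal if $I=I_t$, and $t$-invertible if $(II^{-1})_t=R$. Call $R$ a Prüfer $v$-multiplication domain (PVMD) if every nonzero finitely generated ideal of $R$ is $t$-invertible. A packet is a $t$-invertible $t$-ideal $I\subseteq R$ having exactly one minimal prime (prime ideal of $R$ minimal over $I$). Theorem. Let $R$ be a PVMD and let $X\subsetneq R$ be a $t$-invertible $t$-ideal. Then $X$ is a $t$-product of finitely many packets, i.e. $X=(X_1X_2\cdots X_n)_t$ for some packets $X_1,\dots,X_n$, if and only if $X$ has only finitely many minimal primes (prime ideals of $R$ minimal over $X$). -/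

import Mathlib

open scoped nonZeroDivisors

noncomputable section

namespace FractionalIdeal

variable {R : Type*} [CommRing R] [IsDomain R] {K : Type*} [Field K] [Algebra R K]
  [IsFractionRing R K]

/-- The `v`-closure (divisorial closure) `I_v = (I⁻¹)⁻¹` of a fractional ideal, where
`J⁻¹ = (R : J) = {x ∈ K | x J ⊆ R}` for `J ≠ 0` (and `0⁻¹ = 0`). -/
def vClosure (I : FractionalIdeal R⁰ K) : FractionalIdeal R⁰ K := (I⁻¹)⁻¹

theorem vClosure_zero : vClosure (0 : FractionalIdeal R⁰ K) = 0 := by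
  simp [vClosure, FractionalIdeal.inv_zero']

theorem inv_ne_zero_of_ne_zero {I : FractionalIdeal R⁰ K} (hI : I ≠ 0) : I⁻¹ ≠ 0 := by
  obtain ⟨a, J, ha, h⟩ := FractionalIdeal.exists_eq_spanSingleton_mul I
  intro h0
  have hmem : algebraMap R K a ∈ I⁻¹ := by
    rw [FractionalIdeal.mem_inv_iff hI]
    intro y hy
    rw [h, FractionalIdeal.mem_singleton_mul] at hy
    obtain ⟨y', hy', rfl⟩ := hy
    rw [mul_inv_cancel_left₀ (by simpa using ha)]
    exact FractionalIdeal.coeIdeal_le_one hy'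
  rw [h0, FractionalIdeal.mem_zero_iff] at hmem
  exact ha (by simpa using hmem)

theorem vClosure_mono {I J : FractionalIdeal R⁰ K} (h : I ≤ J) : vClosure I ≤ vClosure J := by
  by_cases hI : I = 0
  · subst hI
    rw [vClosure_zero]
    exact FractionalIdeal.zero_le _
  · have hJ : J ≠ 0 := by
      rintro rfl
      exact hI (le_antisymm h (FractionalIdeal.zero_le _))
    exact FractionalIdeal.inv_anti_mono (inv_ne_zero_of_ne_zero hJ) (inv_ne_zero_of_ne_zero hI)
      (FractionalIdeal.inv_anti_mono hI hJ h)

/-- The `t`-closure `I_t = ⋃ {J_v : J ⊆ I, J finitely generated}` of a fractional ideal. -/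
def tClosure (I : FractionalIdeal R⁰ K) : FractionalIdeal R⁰ K :=
  ⟨{ carrier := {x | ∃ J : FractionalIdeal R⁰ K,
        J ≤ I ∧ (J : Submodule R K).FG ∧ x ∈ vClosure J}
     zero_mem' := ⟨0, FractionalIdeal.zero_le _, by simpa using Submodule.fg_bot,
        Submodule.zero_mem (vClosure (0 : FractionalIdeal R⁰ K) : Submodule R K)⟩
     add_mem' := by
        rintro x y ⟨J, hJ, hJfg, hx⟩ ⟨L, hL, hLfg, hy⟩
        refine ⟨J ⊔ L, sup_le hJ hL, ?_, ?_⟩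
        · rw [FractionalIdeal.coe_sup]
          exact hJfg.sup hLfg
        · exact Submodule.add_mem (vClosure (J ⊔ L) : Submodule R K)
            (vClosure_mono le_sup_left hx) (vClosure_mono le_sup_right hy)
     smul_mem' := by
        rintro c x ⟨J, hJ, hJfg, hx⟩
        exact ⟨J, hJ, hJfg, Submodule.smul_mem (vClosure J : Submodule R K) c hx⟩ },
    FractionalIdeal.isFractional_of_le (J := vClosure I) (by
      rintro x ⟨J, hJ, -, hx⟩
      exact vClosure_mono hJ hx)⟩

theorem mem_tClosure {I : FractionalIdeal R⁰ K} {x : K} :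
    x ∈ tClosure I ↔ ∃ J : FractionalIdeal R⁰ K,
      J ≤ I ∧ (J : Submodule R K).FG ∧ x ∈ vClosure J :=
  Iff.rfl

/-- A `t`-ideal: a nonzero fractional ideal `I` with `I = I_t`. -/
def IsTIdeal (I : FractionalIdeal R⁰ K) : Prop := I ≠ 0 ∧ tClosure I = I

/-- A nonzero fractional ideal `I` is `t`-invertible if `(I I⁻¹)_t = R`. -/
def IsTInvertible (I : FractionalIdeal R⁰ K) : Prop := I ≠ 0 ∧ tClosure (I * I⁻¹) = 1

end FractionalIdeal

/-- A domain `R` with quotient field `K` is a Prüfer `v`-multiplication domain (PVMD) if every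
nonzero finitely generated ideal of `R` is `t`-invertible. -/
def IsPVMD (R : Type*) [CommRing R] [IsDomain R] (K : Type*) [Field K] [Algebra R K]
    [IsFractionRing R K] : Prop :=
  ∀ I : Ideal R, I ≠ ⊥ → I.FG → FractionalIdeal.IsTInvertible (I : FractionalIdeal R⁰ K)

/-- A packet: a `t`-invertible `t`-ideal `I ⊆ R` with a unique minimal prime. -/
def IsPacket {R : Type*} [CommRing R] [IsDomain R] (K : Type*) [Field K] [Algebra R K]
    [IsFractionRing R K] (I : Ideal R) : Prop :=
  FractionalIdeal.IsTIdeal (I : FractionalIdeal R⁰ K) ∧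
    FractionalIdeal.IsTInvertible (I : FractionalIdeal R⁰ K) ∧
    ∃! P : Ideal R, P ∈ I.minimalPrimes

/-- `X` is a `t`-product of finitely many packets: `X = (Y₁ Y₂ ⋯ Yₙ)_t` with all `Yᵢ` packets. -/
def IsTProductOfPackets {R : Type*} [CommRing R] [IsDomain R] (K : Type*) [Field K] [Algebra R K]
    [IsFractionRing R K] (X : Ideal R) : Prop :=
  ∃ (n : ℕ) (Y : Fin n → Ideal R), (∀ i, IsPacket K (Y i)) ∧
    (X : FractionalIdeal R⁰ K) =
      FractionalIdeal.tClosure (∏ i, (Y i : FractionalIdeal R⁰ K))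

end

/-! If `X` is a `t`-product of packets, a prime minimal over `X` contains some factor; that factor
contains `X`, so the prime is minimal over it and is its unique minimal prime. Conversely, write `X
= F_v` with `F` finitely generated, and let `P i` be the minimal primes of `X`. They are pairwise
incomparable, so the PVMD hypothesis yields finitely generated `A i ≤ P i` that are pairwise
`v`-comaximal (`IsPVMD.exists_pairwise_isVComaximal`), and some power `m` of `∏ A i` lies in `X`.
The packets are `Y i = (F + A i ^ m)_v`. A prime minimal over `Y i` is closed under `v`-closures of
finitely generated subideals (`vClosure_le_of_mem_minimalPrimes`), so comaximality forbids it from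
containing `P j` for `j ≠ i`. Finally `X = (∏ Y i)_t`: one inclusion is a Chinese remainder argument
(`le_vClosure_prod_of_pairwise`), the other expands the product (`prod_add_le_add_prod`). -/

open FractionalIdeal

/-! ### Finitely generated ideals: products and minimal primes. -/

section FiniteGeneration

/-- A finitely generated submodule of a product lies in a product of finitely generated
submodules of the factors. -/
theorem Submodule.exists_fg_le_mul {R A : Type*} [CommSemiring R] [CommSemiring A] [Algebra R A]
    {G M N : Submodule R A} (hG : G.FG) (h : G ≤ M * N) :
    ∃ M' ≤ M, ∃ N' ≤ N, M'.FG ∧ N'.FG ∧ G ≤ M' * N' := by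
  induction G, hG using Submodule.fg_induction with
  | singleton x =>
    obtain ⟨T, T', hT, hT', hx⟩ := Submodule.mem_span_mul_finite_of_mem_mul
      (h (Submodule.mem_span_singleton_self x))
    refine ⟨_, Submodule.span_le.2 hT, _, Submodule.span_le.2 hT', Submodule.fg_span T.finite_toSet,
      Submodule.fg_span T'.finite_toSet, ?_⟩
    rwa [Submodule.span_mul_span, Submodule.span_singleton_le_iff_mem]
  | sup G₁ G₂ _ _ h₁ h₂ =>
    obtain ⟨M₁, hM₁, N₁, hN₁, fM₁, fN₁, k₁⟩ := h₁ (le_sup_left.trans h)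
    obtain ⟨M₂, hM₂, N₂, hN₂, fM₂, fN₂, k₂⟩ := h₂ (le_sup_right.trans h)
    exact ⟨M₁ ⊔ M₂, sup_le hM₁ hM₂, N₁ ⊔ N₂, sup_le hN₁ hN₂, fM₁.sup fM₂, fN₁.sup fN₂,
      sup_le (k₁.trans (mul_le_mul' le_sup_left le_sup_left))
        (k₂.trans (mul_le_mul' le_sup_right le_sup_right))⟩

/-- If `Q` is minimal over `I`, a finitely generated `J ≤ Q` satisfies `s Jⁿ ≤ I` for some
`s ∉ Q` and some `n`. -/
theorem Ideal.exists_span_singleton_mul_pow_le_of_mem_minimalPrimes {R : Type*} [CommRing R]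
    {I Q J : Ideal R} (hQ : Q ∈ I.minimalPrimes) (hJ : J.FG) (hJQ : J ≤ Q) :
    ∃ s ∉ Q, ∃ n : ℕ, Ideal.span {s} * J ^ n ≤ I := by
  have := hQ.1.1
  let A := Localization.AtPrime Q
  -- In the localization at `Q`, the extension of `Q` is the radical of that of `I`; the inclusion
  -- found there is pulled back by clearing denominators, one per generator.
  have hrad : J.map (algebraMap R A) ≤ (I.map (algebraMap R A)).radical := by
    rw [IsLocalization.AtPrime.radical_map_of_mem_minimalPrimes (A := A) Q I hQ]
    exact Ideal.map_mono hJQ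
  obtain ⟨n, hn⟩ := Ideal.exists_pow_le_of_le_radical_of_fg hrad (hJ.map _)
  rw [← Ideal.map_pow, Ideal.map_le_iff_le_comap] at hn
  suffices H : ∀ L : Ideal R, L.FG → L ≤ (I.map (algebraMap R A)).comap (algebraMap R A) →
      ∃ s ∉ Q, Ideal.span {s} * L ≤ I by
    obtain ⟨s, hs, h⟩ := H _ (hJ.pow (n := n)) hn
    exact ⟨s, hs, n, h⟩
  intro L hL h
  induction L, hL using Submodule.fg_induction with
  | singleton x =>
    have hx : algebraMap R A x ∈ I.map (algebraMap R A) :=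
      h (Submodule.mem_span_singleton_self x)
    rw [IsLocalization.algebraMap_mem_map_algebraMap_iff Q.primeCompl] at hx
    obtain ⟨s, hs, hsx⟩ := hx
    refine ⟨s, hs, ?_⟩
    rw [Ideal.submodule_span_eq, Ideal.span_singleton_mul_span_singleton,
      Ideal.span_singleton_le_iff_mem]
    exact hsx
  | sup L₁ L₂ _ _ h₁ h₂ =>
    obtain ⟨s₁, hs₁, k₁⟩ := h₁ (le_sup_left.trans h)
    obtain ⟨s₂, hs₂, k₂⟩ := h₂ (le_sup_right.trans h)
    refine ⟨s₁ * s₂, fun hs => (this.mem_or_mem hs).elim hs₁ hs₂, ?_⟩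
    rw [← Ideal.span_singleton_mul_span_singleton, Ideal.mul_sup]
    refine sup_le ?_ ?_
    · rw [mul_right_comm]
      exact Ideal.mul_le_left.trans k₁
    · rw [mul_assoc]
      exact Ideal.mul_le_right.trans k₂

theorem Ideal.fg_finset_prod {R ι : Type*} [CommSemiring R] (s : Finset ι) {I : ι → Ideal R}
    (h : ∀ i ∈ s, (I i).FG) : (∏ i ∈ s, I i).FG :=
  Finset.prod_induction I (fun J : Ideal R => J.FG) (fun _ _ h₁ h₂ => Submodule.FG.mul h₁ h₂)
    ⟨{1}, by simp⟩ h

end FiniteGeneration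

/-! ### Calculus of the `v`- and `t`-closures. -/

namespace FractionalIdeal

variable {R : Type*} [CommRing R] [IsDomain R] {K : Type*} [Field K] [Algebra R K]
  [IsFractionRing R K]

theorem le_inv_iff_mul_le_one {A I : FractionalIdeal R⁰ K} (hI : I ≠ 0) :
    A ≤ I⁻¹ ↔ A * I ≤ 1 :=
  le_div_iff_mul_le hI

theorem le_vClosure_iff {A I : FractionalIdeal R⁰ K} (hI : I ≠ 0) :
    A ≤ vClosure I ↔ A * I⁻¹ ≤ 1 :=
  le_div_iff_mul_le (inv_ne_zero_of_ne_zero hI)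

theorem mul_inv_le_one (I : FractionalIdeal R⁰ K) : I * I⁻¹ ≤ 1 :=
  mul_one_div_le_one

theorem le_vClosure (I : FractionalIdeal R⁰ K) : I ≤ vClosure I := by
  rcases eq_or_ne I 0 with rfl | hI
  · exact zero_le _
  · exact (le_vClosure_iff hI).2 (mul_inv_le_one I)

theorem vClosure_ne_zero {I : FractionalIdeal R⁰ K} (hI : I ≠ 0) : vClosure I ≠ 0 :=
  inv_ne_zero_of_ne_zero (inv_ne_zero_of_ne_zero hI)

theorem inv_vClosure {I : FractionalIdeal R⁰ K} (hI : I ≠ 0) : (vClosure I)⁻¹ = I⁻¹ := by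
  refine le_antisymm (inv_anti_mono hI (vClosure_ne_zero hI) (le_vClosure I)) ?_
  rw [le_inv_iff_mul_le_one (vClosure_ne_zero hI), mul_comm, ← le_vClosure_iff hI]

theorem vClosure_vClosure (I : FractionalIdeal R⁰ K) : vClosure (vClosure I) = vClosure I := by
  rcases eq_or_ne I 0 with rfl | hI
  · simp only [vClosure_zero]
  · rw [vClosure, inv_vClosure hI, vClosure]

theorem vClosure_le_vClosure_of_le {I J : FractionalIdeal R⁰ K} (h : I ≤ vClosure J) :
    vClosure I ≤ vClosure J :=
  (vClosure_mono h).trans (vClosure_vClosure J).le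

theorem vClosure_one : vClosure (1 : FractionalIdeal R⁰ K) = 1 := by
  simp [vClosure]

theorem vClosure_le_one {I : FractionalIdeal R⁰ K} (hI : I ≤ 1) : vClosure I ≤ 1 :=
  (vClosure_mono hI).trans vClosure_one.le

/-- Trade one factor at a time against the inverse: `J (IJ)⁻¹ ≤ I⁻¹`, hence `I_v (IJ)⁻¹ ≤ J⁻¹`, and
`J_v` multiplies the latter into `R`. -/
theorem vClosure_mul_vClosure_le (I J : FractionalIdeal R⁰ K) :
    vClosure I * vClosure J ≤ vClosure (I * J) := by
  rcases eq_or_ne I 0 with rfl | hI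
  · simp [vClosure_zero]
  rcases eq_or_ne J 0 with rfl | hJ
  · simp [vClosure_zero]
  have hIJ : I * J ≠ 0 := fun h => by
    rw [← coeToSubmodule_eq_bot, coe_mul, Submodule.mul_eq_bot, coeToSubmodule_eq_bot,
      coeToSubmodule_eq_bot] at h
    exact h.elim hI hJ
  have h₁ : J * (I * J)⁻¹ ≤ I⁻¹ := by
    rw [le_inv_iff_mul_le_one hI, mul_right_comm, mul_comm J]
    exact mul_inv_le_one _
  have h₂ : vClosure I * (I * J)⁻¹ ≤ J⁻¹ := by
    rw [le_inv_iff_mul_le_one hJ, mul_assoc, mul_comm _ J]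
    exact (mul_le_mul_right h₁ _).trans ((le_vClosure_iff hI).1 le_rfl)
  rw [le_vClosure_iff hIJ, mul_comm (vClosure I), mul_assoc]
  exact (mul_le_mul_right h₂ _).trans ((le_vClosure_iff hJ).1 le_rfl)

theorem mul_le_vClosure_mul {A B I J : FractionalIdeal R⁰ K} (hA : A ≤ vClosure I)
    (hB : B ≤ vClosure J) : A * B ≤ vClosure (I * J) :=
  (mul_le_mul' hA hB).trans (vClosure_mul_vClosure_le I J)

theorem prod_le_vClosure_prod {ι : Type*} (s : Finset ι) {A I : ι → FractionalIdeal R⁰ K}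
    (h : ∀ i ∈ s, A i ≤ vClosure (I i)) : ∏ i ∈ s, A i ≤ vClosure (∏ i ∈ s, I i) := by
  classical
  induction s using Finset.induction_on with
  | empty => simp [vClosure_one]
  | insert i s hi ih =>
    rw [Finset.prod_insert hi, Finset.prod_insert hi]
    exact mul_le_vClosure_mul (h i (Finset.mem_insert_self i s))
      (ih fun j hj => h j (Finset.mem_insert_of_mem hj))

theorem vClosure_le_tClosure {I J : FractionalIdeal R⁰ K} (hJ : (J : Submodule R K).FG)
    (h : J ≤ I) : vClosure J ≤ tClosure I :=
  fun _ hx => ⟨J, h, hJ, hx⟩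

theorem tClosure_le_vClosure (I : FractionalIdeal R⁰ K) : tClosure I ≤ vClosure I := by
  rintro x ⟨J, hJ, -, hx⟩
  exact vClosure_mono hJ hx

theorem tClosure_mono {I J : FractionalIdeal R⁰ K} (h : I ≤ J) : tClosure I ≤ tClosure J := by
  rintro x ⟨L, hL, hLfg, hx⟩
  exact ⟨L, hL.trans h, hLfg, hx⟩

theorem le_tClosure (I : FractionalIdeal R⁰ K) : I ≤ tClosure I := by
  intro x hx
  refine ⟨spanSingleton R⁰ x, spanSingleton_le_iff_mem.2 hx, ?_, le_vClosure _ ?_⟩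
  · rw [coe_spanSingleton]
    exact Submodule.fg_span_singleton x
  · exact mem_spanSingleton_self R⁰ x

/-- A divisorial ideal is a `t`-ideal. -/
theorem tClosure_vClosure (I : FractionalIdeal R⁰ K) : tClosure (vClosure I) = vClosure I :=
  le_antisymm ((tClosure_le_vClosure _).trans (vClosure_vClosure I).le) (le_tClosure _)

theorem tClosure_le_one {I : FractionalIdeal R⁰ K} (hI : I ≤ 1) : tClosure I ≤ 1 :=
  (tClosure_le_vClosure I).trans (vClosure_le_one hI)

/-- `t`-invertibility passes to the `v`-closure. -/
theorem IsTInvertible.vClosure {I : FractionalIdeal R⁰ K} (h : IsTInvertible I) :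
    IsTInvertible (vClosure I) := by
  refine ⟨vClosure_ne_zero h.1, le_antisymm (tClosure_le_one (mul_inv_le_one _)) ?_⟩
  rw [← h.2, inv_vClosure h.1]
  exact tClosure_mono (mul_le_mul_left (le_vClosure I) _)

/-- A `t`-invertible ideal is `t`-invertible by means of finitely generated subideals of `I` and
`I⁻¹`. -/
theorem IsTInvertible.exists_fg {I : FractionalIdeal R⁰ K} (h : IsTInvertible I) :
    ∃ J ≤ I, ∃ L ≤ I⁻¹, (J : Submodule R K).FG ∧ (L : Submodule R K).FG ∧
      1 ≤ FractionalIdeal.vClosure (J * L) := by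
  have h1 : (1 : K) ∈ tClosure (I * I⁻¹) := h.2 ▸ one_mem_one R⁰
  obtain ⟨G, hG, hGfg, h1⟩ := h1
  have hG' : (G : Submodule R K) ≤ I * (I⁻¹ : FractionalIdeal R⁰ K) := by
    rw [← coe_mul]
    exact hG
  obtain ⟨J, hJ, L, hL, hJfg, hLfg, hle⟩ := Submodule.exists_fg_le_mul hGfg hG'
  let J' : FractionalIdeal R⁰ K := ⟨J, isFractional_of_le hJ⟩
  let L' : FractionalIdeal R⁰ K := ⟨L, isFractional_of_le hL⟩
  refine ⟨J', hJ, L', hL, hJfg, hLfg, (one_le.2 h1).trans (vClosure_mono ?_)⟩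
  rw [← coe_le_coe, coe_mul]
  exact hle

omit [IsDomain R] in
theorem fg_coeIdeal_iff {I : Ideal R} :
    ((I : FractionalIdeal R⁰ K) : Submodule R K).FG ↔ I.FG :=
  coeIdeal_fg R⁰ (IsFractionRing.injective R K) I

omit [IsDomain R] in
theorem exists_fg_coeIdeal_eq {P : Ideal R} {A : FractionalIdeal R⁰ K}
    (hA : A ≤ P) (hfg : (A : Submodule R K).FG) :
    ∃ J : Ideal R, J ≤ P ∧ J.FG ∧ (J : FractionalIdeal R⁰ K) = A := by
  obtain ⟨J, rfl⟩ := le_one_iff_exists_coeIdeal.1 (hA.trans coeIdeal_le_one)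
  exact ⟨J, (coeIdeal_le_coeIdeal K).1 hA, fg_coeIdeal_iff.1 hfg, rfl⟩

/-- A `t`-invertible `t`-ideal is the `v`-closure of a finitely generated subideal. -/
theorem IsTInvertible.exists_fg_vClosure_eq {X : Ideal R}
    (hX : IsTInvertible (X : FractionalIdeal R⁰ K)) (ht : IsTIdeal (X : FractionalIdeal R⁰ K)) :
    ∃ F : Ideal R, F ≤ X ∧ F.FG ∧
      FractionalIdeal.vClosure (F : FractionalIdeal R⁰ K) = X := by
  obtain ⟨J, hJ, L, hL, hJfg, -, h1⟩ := hX.exists_fg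
  obtain ⟨F, hF, hFfg, rfl⟩ := exists_fg_coeIdeal_eq hJ hJfg
  refine ⟨F, hF, hFfg, le_antisymm ?_ ?_⟩
  · exact (vClosure_le_tClosure hJfg hJ).trans ht.2.le
  -- Multiply by `1 ∈ (F L)_v` and absorb `X L ≤ X X⁻¹ ≤ R`.
  · calc (X : FractionalIdeal R⁰ K) = X * 1 := (mul_one _).symm
      _ ≤ FractionalIdeal.vClosure ((X : FractionalIdeal R⁰ K) * ((F : FractionalIdeal R⁰ K) * L)) :=
        mul_le_vClosure_mul (le_vClosure _) h1
      _ ≤ FractionalIdeal.vClosure F := by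
        refine vClosure_mono ?_
        rw [mul_left_comm]
        calc (F : FractionalIdeal R⁰ K) * (X * L) ≤ F * 1 :=
              mul_le_mul_right ((mul_le_mul_right hL _).trans (mul_inv_le_one _)) _
          _ = F := mul_one _

/-- A prime minimal over a `t`-ideal is a `t`-ideal. -/
theorem vClosure_le_of_mem_minimalPrimes {I Q J : Ideal R}
    (hI : tClosure (I : FractionalIdeal R⁰ K) = I) (hQ : Q ∈ I.minimalPrimes) (hJ : J.FG)
    (hJQ : J ≤ Q) : vClosure (J : FractionalIdeal R⁰ K) ≤ Q := by
  have := hQ.1.1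
  obtain ⟨s, hs, n, hle⟩ := Ideal.exists_span_singleton_mul_pow_le_of_mem_minimalPrimes hQ hJ hJQ
  have hfg : (Ideal.span {s} * J ^ n).FG := (Submodule.fg_span_singleton s).mul (hJ.pow (n := n))
  have hv : vClosure ((Ideal.span {s} * J ^ n : Ideal R) : FractionalIdeal R⁰ K) ≤ I :=
    (vClosure_le_tClosure (fg_coeIdeal_iff.2 hfg) ((coeIdeal_le_coeIdeal K).2 hle)).trans hI.le
  intro x hx
  obtain ⟨r, rfl⟩ := (mem_one_iff R⁰).1 (vClosure_le_one coeIdeal_le_one hx)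
  -- From `r ∈ J_v` follows `r ^ n ∈ (J ^ n)_v`, so `s * r ^ n ∈ I ≤ Q` with `s ∉ Q`.
  have hpow : spanSingleton R⁰ (algebraMap R K r) ^ n ≤
      vClosure ((J : FractionalIdeal R⁰ K) ^ n) := by
    simpa using prod_le_vClosure_prod (Finset.range n)
      (A := fun _ => spanSingleton R⁰ (algebraMap R K r)) (I := fun _ => J)
      fun _ _ => spanSingleton_le_iff_mem.2 hx
  have hmul : spanSingleton R⁰ (algebraMap R K (s * r ^ n)) ≤ (I : FractionalIdeal R⁰ K) := by
    refine le_trans ?_ hv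
    rw [coeIdeal_mul, coeIdeal_pow, coeIdeal_span_singleton, map_mul, map_pow,
      ← spanSingleton_mul_spanSingleton, ← spanSingleton_pow]
    exact mul_le_vClosure_mul (le_vClosure _) hpow
  rw [← coeIdeal_span_singleton, coeIdeal_le_coeIdeal K, Ideal.span_singleton_le_iff_mem] at hmul
  exact mem_coeIdeal_of_mem _
    (this.mem_of_pow_mem n ((this.mem_or_mem (hQ.1.2 hmul)).resolve_left hs))

/-! ### `v`-comaximal ideals, and their existence in a PVMD. -/

/-- Two fractional ideals are `v`-comaximal if the `v`-closure of their sum contains `1`. -/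
def IsVComaximal (I J : FractionalIdeal R⁰ K) : Prop := 1 ≤ vClosure (I + J)

theorem IsVComaximal.symm {I J : FractionalIdeal R⁰ K} (h : IsVComaximal I J) :
    IsVComaximal J I := by
  rwa [IsVComaximal, add_comm]

theorem IsVComaximal.mono {I J I' J' : FractionalIdeal R⁰ K} (h : IsVComaximal I J) (hI : I ≤ I')
    (hJ : J ≤ J') : IsVComaximal I' J' :=
  le_trans h (vClosure_mono (add_le_add hI hJ))

/-- For integral ideals, `(I + L)(J + L) ≤ IJ + L`. -/
theorem IsVComaximal.mul_left {I J L : FractionalIdeal R⁰ K} (hI : IsVComaximal I L)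
    (hJ : IsVComaximal J L) (hI1 : I ≤ 1) (hJ1 : J ≤ 1) (hL1 : L ≤ 1) :
    IsVComaximal (I * J) L := by
  have h := mul_le_vClosure_mul hI hJ
  rw [mul_one] at h
  refine h.trans (vClosure_mono ?_)
  rw [add_mul, mul_add, mul_add, add_assoc]
  refine add_le_add le_rfl ?_
  simp only [← sup_eq_add]
  exact sup_le (mul_le_of_le_one_left' hI1)
    (sup_le (mul_le_of_le_one_right' hJ1) (mul_le_of_le_one_left' hL1))

theorem IsVComaximal.prod_left {ι : Type*} (s : Finset ι) {I : ι → FractionalIdeal R⁰ K}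
    {L : FractionalIdeal R⁰ K} (h : ∀ i ∈ s, IsVComaximal (I i) L) (hI : ∀ i ∈ s, I i ≤ 1)
    (hL : L ≤ 1) : IsVComaximal (∏ i ∈ s, I i) L := by
  classical
  induction s using Finset.induction_on with
  | empty =>
    rw [Finset.prod_empty, IsVComaximal, ← sup_eq_add]
    exact le_sup_left.trans (le_vClosure _)
  | insert i s hi ih =>
    rw [Finset.prod_insert hi]
    have hs : ∀ j ∈ s, I j ≤ 1 := fun j hj => hI j (Finset.mem_insert_of_mem hj)
    exact (h i (Finset.mem_insert_self i s)).mul_left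
      (ih (fun j hj => h j (Finset.mem_insert_of_mem hj)) hs)
      (hI i (Finset.mem_insert_self i s)) (Finset.prod_le_one' hs) hL

theorem IsVComaximal.pow_left {I L : FractionalIdeal R⁰ K} (h : IsVComaximal I L) (hI : I ≤ 1)
    (hL : L ≤ 1) (n : ℕ) : IsVComaximal (I ^ n) L := by
  simpa using IsVComaximal.prod_left (Finset.range n) (fun _ _ => h) (fun _ _ => hI) hL

/-- An ideal contained in each of a finite family of pairwise `v`-comaximal ideals lies in the
`v`-closure of their product. -/
theorem le_vClosure_prod_of_pairwise {ι : Type*} (s : Finset ι) {I : ι → FractionalIdeal R⁰ K}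
    {F : FractionalIdeal R⁰ K} (hI : ∀ i ∈ s, I i ≤ 1) (hF1 : F ≤ 1) (hF : ∀ i ∈ s, F ≤ I i)
    (h : ∀ i ∈ s, ∀ j ∈ s, i ≠ j → IsVComaximal (I i) (I j)) :
    F ≤ vClosure (∏ i ∈ s, I i) := by
  classical
  induction s using Finset.induction_on with
  | empty => simpa [vClosure_one] using hF1
  | insert i s hi ih =>
    rw [Finset.prod_insert hi]
    have hi' := Finset.mem_insert_self i s
    have hs : ∀ {j}, j ∈ s → j ∈ insert i s := Finset.mem_insert_of_mem
    have hcop : IsVComaximal (∏ j ∈ s, I j) (I i) :=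
      IsVComaximal.prod_left s
        (fun j hj => h j (hs hj) i hi' fun hji => hi (hji ▸ hj))
        (fun j hj => hI j (hs hj)) (hI i hi')
    have ih := ih (fun j hj => hI j (hs hj)) (fun j hj => hF j (hs hj))
      fun j hj k hk => h j (hs hj) k (hs hk)
    -- Since `F ≤ I i`, the term `F ∏ I j` is harmless; in `F * I i`, induction puts `F` in `(∏ I
    -- j)_v`.
    calc F = F * 1 := (mul_one F).symm
      _ ≤ vClosure (F * (∏ j ∈ s, I j + I i)) := mul_le_vClosure_mul (le_vClosure F) hcop
      _ ≤ vClosure (I i * ∏ j ∈ s, I j) := by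
        refine vClosure_le_vClosure_of_le ?_
        rw [mul_add, ← sup_eq_add]
        refine sup_le ((mul_le_mul_left (hF i hi') _).trans (le_vClosure _)) ?_
        rw [mul_comm]
        exact mul_le_vClosure_mul (le_vClosure _) ih

omit [IsDomain R] [IsFractionRing R K] in
theorem prod_add_le_add_prod {ι : Type*} (s : Finset ι) {B : ι → FractionalIdeal R⁰ K}
    {F : FractionalIdeal R⁰ K} (hB : ∀ i ∈ s, B i ≤ 1) (hF : F ≤ 1) :
    ∏ i ∈ s, (F + B i) ≤ F + ∏ i ∈ s, B i := by
  classical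
  induction s using Finset.induction_on with
  | empty =>
    rw [Finset.prod_empty, Finset.prod_empty, ← sup_eq_add]
    exact le_sup_right
  | insert i s hi ih =>
    have hs : ∀ j ∈ s, B j ≤ 1 := fun j hj => hB j (Finset.mem_insert_of_mem hj)
    rw [Finset.prod_insert hi, Finset.prod_insert hi]
    refine (mul_le_mul_right (ih hs) _).trans ?_
    rw [add_mul, mul_add (B i)]
    simp only [← sup_eq_add]
    refine sup_le ?_ (sup_le ?_ le_sup_right)
    · exact (mul_le_of_le_one_right'
        (sup_le hF (Finset.prod_le_one' hs))).trans le_sup_left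
    · exact (mul_le_of_le_one_left' (hB i (Finset.mem_insert_self i s))).trans le_sup_left

/-- In a PVMD, incomparable primes contain `v`-comaximal finitely generated ideals. -/
theorem _root_.IsPVMD.exists_isVComaximal (hR : IsPVMD R K) {P Q : Ideal R} [P.IsPrime]
    [Q.IsPrime] (hPQ : ¬ P ≤ Q) (hQP : ¬ Q ≤ P) :
    ∃ A B : Ideal R, A ≤ P ∧ B ≤ Q ∧ A.FG ∧ B.FG ∧
      IsVComaximal (A : FractionalIdeal R⁰ K) (B : FractionalIdeal R⁰ K) := by
  obtain ⟨x, hxP, hxQ⟩ := SetLike.not_le_iff_exists.1 hPQ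
  obtain ⟨y, hyQ, hyP⟩ := SetLike.not_le_iff_exists.1 hQP
  have hne : Ideal.span {x, y} ≠ ⊥ := fun h =>
    hxQ (by rw [(Ideal.span_eq_bot.1 h) x (by simp)]; exact Q.zero_mem)
  -- With `L ≤ (x, y)⁻¹` as here, `A = xL` and `B = yL` will do: their sum is `(x, y) L`.
  obtain ⟨J, hJ, L, hL, -, hLfg, h1⟩ := (hR _ hne (Submodule.fg_span (by simp))).exists_fg
  have key : ∀ {P : Ideal R} [P.IsPrime] {u w : R}, u ∈ P → w ∉ P → u ∈ Ideal.span {x, y} →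
      w ∈ Ideal.span {x, y} → ∃ A : Ideal R, A ≤ P ∧ A.FG ∧
        (A : FractionalIdeal R⁰ K) = spanSingleton R⁰ (algebraMap R K u) * L := by
    intro P hP u w hu hw huJ hwJ
    have mul_mem : ∀ {z : R}, z ∈ Ideal.span {x, y} → ∀ l ∈ L,
        ∃ r, algebraMap R K r = algebraMap R K z * l := fun {z} hz l hl =>
      (mem_one_iff R⁰).1 (mul_inv_le_one _ (mul_mem_mul (mem_coeIdeal_of_mem R⁰ hz) (hL hl)))
    refine exists_fg_coeIdeal_eq ?_ ?_
    · rw [spanSingleton_mul_le_iff]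
      intro l hl
      obtain ⟨r, hr⟩ := mul_mem huJ l hl
      obtain ⟨t, ht⟩ := mul_mem hwJ l hl
      -- For `r = u l` and `t = w l` in `R`, the product `r w = u t` lies in `P` while `w` does not.
      have hrt : r * w = u * t := by
        apply IsFractionRing.injective R K
        rw [map_mul, map_mul, hr, ht]
        ring
      rw [← hr]
      refine mem_coeIdeal_of_mem R⁰ ((hP.mem_or_mem (y := w) ?_).resolve_right hw)
      rw [hrt]
      exact P.mul_mem_right t hu
    · rw [coe_mul, coe_spanSingleton]
      exact (Submodule.fg_span_singleton _).mul hLfg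
  have hx : x ∈ Ideal.span {x, y} := Ideal.subset_span (by simp)
  have hy : y ∈ Ideal.span {x, y} := Ideal.subset_span (by simp)
  obtain ⟨A, hA, hAfg, hAeq⟩ := key hxP hyP hx hy
  obtain ⟨B, hB, hBfg, hBeq⟩ := key hyQ hxQ hy hx
  refine ⟨A, B, hA, hB, hAfg, hBfg, le_trans h1 (vClosure_mono ?_)⟩
  rw [hAeq, hBeq, ← add_mul, ← coeIdeal_span_singleton, ← coeIdeal_span_singleton, ← coeIdeal_sup,
    ← Ideal.span_insert]
  exact mul_le_mul_left hJ L

/-- In a PVMD, a finite family of pairwise incomparable primes contains a family of pairwise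
`v`-comaximal finitely generated ideals. -/
theorem _root_.IsPVMD.exists_pairwise_isVComaximal (hR : IsPVMD R K) {ι : Type*} [Finite ι]
    {P : ι → Ideal R} (hP : ∀ i, (P i).IsPrime) (hinc : ∀ i j, i ≠ j → ¬ P i ≤ P j) :
    ∃ A : ι → Ideal R, (∀ i, A i ≤ P i) ∧ (∀ i, (A i).FG) ∧
      ∀ i j, i ≠ j → IsVComaximal (A i : FractionalIdeal R⁰ K) (A j : FractionalIdeal R⁰ K) := by
  classical
  have := Fintype.ofFinite ι
  have hpair : ∀ i j, ∃ A B : Ideal R, A ≤ P i ∧ B ≤ P j ∧ A.FG ∧ B.FG ∧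
      (i ≠ j → IsVComaximal (A : FractionalIdeal R⁰ K) (B : FractionalIdeal R⁰ K)) := by
    intro i j
    by_cases hij : i = j
    · exact ⟨⊥, ⊥, bot_le, bot_le, Submodule.fg_bot, Submodule.fg_bot, fun h => (h hij).elim⟩
    · have := hP i
      have := hP j
      obtain ⟨A, B, hA, hB, hAf, hBf, h⟩ :=
        hR.exists_isVComaximal (hinc i j hij) (hinc j i (Ne.symm hij))
      exact ⟨A, B, hA, hB, hAf, hBf, fun _ => h⟩
  choose A B hA hB hAf hBf h using hpair
  -- Enlarging preserves comaximality, so each index collects its ideals from all pairs, in either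
  -- position.
  refine ⟨fun i => Finset.univ.sup fun j => A i j ⊔ B j i,
    fun i => Finset.sup_le fun j _ => sup_le (hA i j) (hB j i),
    fun i => Submodule.fg_finset_sup _ _ fun j _ => Submodule.FG.sup (hAf i j) (hBf j i), ?_⟩
  intro i j hij
  refine (h i j hij).mono ((coeIdeal_le_coeIdeal K).2 ?_) ((coeIdeal_le_coeIdeal K).2 ?_)
  · exact le_sup_left.trans
      (Finset.le_sup (f := fun j => A i j ⊔ B j i) (Finset.mem_univ j))
  · exact le_sup_right.trans
      (Finset.le_sup (f := fun i => A j i ⊔ B i j) (Finset.mem_univ i))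

end FractionalIdeal

/-! ### Packets and minimal primes. -/

section Packets

variable {R : Type*} [CommRing R] [IsDomain R] {K : Type*} [Field K] [Algebra R K]
  [IsFractionRing R K]

theorem IsTProductOfPackets.finite_minimalPrimes {X : Ideal R} (h : IsTProductOfPackets K X) :
    X.minimalPrimes.Finite := by
  obtain ⟨n, Y, hY, hX⟩ := h
  have hprod : (∏ i, (Y i : FractionalIdeal R⁰ K)) = ((∏ i, Y i : Ideal R) : FractionalIdeal R⁰ K) :=
    (map_prod (coeIdealHom R⁰ K) Y Finset.univ).symm
  have hle : ∏ i, Y i ≤ X := by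
    rw [← coeIdeal_le_coeIdeal K, hX, ← hprod]
    exact le_tClosure _
  have hXY : ∀ i, X ≤ Y i := by
    intro i
    rw [← coeIdeal_le_coeIdeal K, hX, ← (hY i).1.2, hprod]
    exact tClosure_mono ((coeIdeal_le_coeIdeal K).2
      (Ideal.prod_le_inf.trans (Finset.inf_le (Finset.mem_univ i))))
  refine (Set.finite_iUnion (f := fun i => (Y i).minimalPrimes) fun i => ?_).subset ?_
  · obtain ⟨P, -, hP⟩ := (hY i).2.2
    exact (Set.finite_singleton P).subset hP
  · intro P hP
    have := hP.1.1
    obtain ⟨i, -, hi⟩ := (Ideal.IsPrime.prod_le this).1 (hle.trans hP.1.2)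
    exact Set.mem_iUnion.2 ⟨i, ⟨this, hi⟩, fun Q hQ hQP => hP.2 ⟨hQ.1, (hXY i).trans hQ.2⟩ hQP⟩

theorem IsPVMD.isTProductOfPackets (hR : IsPVMD R K) {X : Ideal R}
    (hXt : IsTIdeal (X : FractionalIdeal R⁰ K)) (hXinv : IsTInvertible (X : FractionalIdeal R⁰ K))
    (hfin : X.minimalPrimes.Finite) : IsTProductOfPackets K X := by
  obtain ⟨n, P, hPinj, hPrange⟩ := hfin.fin_param
  have hPmin : ∀ i, P i ∈ X.minimalPrimes := fun i => hPrange ▸ Set.mem_range_self i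
  obtain ⟨A, hAP, hAfg, hAcop⟩ := hR.exists_pairwise_isVComaximal (fun i => (hPmin i).1.1)
    fun i j hij hle => hij (hPinj (le_antisymm hle ((hPmin j).2 (hPmin i).1 hle)))
  obtain ⟨F, hFX, hFfg, hFv⟩ := hXinv.exists_fg_vClosure_eq hXt
  have hF0 : F ≠ ⊥ := by
    rintro rfl
    rw [coeIdeal_bot, vClosure_zero] at hFv
    exact hXt.1 hFv.symm
  have hrad : ∏ i, A i ≤ X.radical := by
    rw [← Ideal.sInf_minimalPrimes]
    refine le_sInf fun Q hQ => ?_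
    rw [← hPrange] at hQ
    obtain ⟨i, rfl⟩ := hQ
    exact Ideal.prod_le_inf.trans ((Finset.inf_le (Finset.mem_univ i)).trans (hAP i))
  have hprodfg : (∏ i, A i).FG :=
    Ideal.fg_finset_prod Finset.univ fun i _ => hAfg i
  obtain ⟨k, hk⟩ := Ideal.exists_pow_le_of_le_radical_of_fg hrad hprodfg
  -- The exponent is raised by one because `A i ^ m ≤ P i` needs `m ≠ 0`.
  obtain ⟨m, hm0, hm⟩ : ∃ m ≠ 0, (∏ i, A i) ^ m ≤ X :=
    ⟨k + 1, k.succ_ne_zero, (Ideal.pow_le_pow_right k.le_succ).trans hk⟩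
  have hAmP : ∀ i, A i ^ m ≤ P i :=
    fun i => (Ideal.pow_le_self hm0).trans (hAP i)
  -- The summand `F` gives `X ≤ (C i)_v`; the powers give comaximality and a product inside `X`.
  let C : Fin n → Ideal R := fun i => F ⊔ A i ^ m
  have hCfg : ∀ i, (C i).FG := fun i => Submodule.FG.sup hFfg ((hAfg i).pow (n := m))
  have hC0 : ∀ i, C i ≠ ⊥ := fun i h => hF0 (le_bot_iff.1 (le_sup_left.trans h.le))
  have hCP : ∀ i, C i ≤ P i := fun i => sup_le (hFX.trans (hPmin i).1.2) (hAmP i)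
  have hCcop : ∀ i j, i ≠ j →
      IsVComaximal (C i : FractionalIdeal R⁰ K) (C j : FractionalIdeal R⁰ K) := by
    intro i j hij
    have h := (((hAcop i j hij).pow_left coeIdeal_le_one coeIdeal_le_one m).symm.pow_left
      coeIdeal_le_one (pow_le_one' coeIdeal_le_one m) m).symm
    rw [← coeIdeal_pow, ← coeIdeal_pow] at h
    exact h.mono ((coeIdeal_le_coeIdeal K).2 le_sup_right)
      ((coeIdeal_le_coeIdeal K).2 le_sup_right)
  have hY : ∀ i, ∃ Y : Ideal R, (Y : FractionalIdeal R⁰ K) = vClosure (C i : FractionalIdeal R⁰ K) :=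
    fun i => le_one_iff_exists_coeIdeal.1 (vClosure_le_one coeIdeal_le_one)
  choose Y hY using hY
  have hCY : ∀ i, C i ≤ Y i := fun i => by
    rw [← coeIdeal_le_coeIdeal K, hY]
    exact le_vClosure _
  have hYP : ∀ i, Y i ≤ P i := fun i => by
    rw [← coeIdeal_le_coeIdeal K, hY]
    exact vClosure_le_of_mem_minimalPrimes hXt.2 (hPmin i) (hCfg i) (hCP i)
  have hXY : ∀ i, X ≤ Y i := fun i => by
    rw [← coeIdeal_le_coeIdeal K, hY, ← hFv]
    exact vClosure_mono ((coeIdeal_le_coeIdeal K).2 le_sup_left)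
  have hYt : ∀ i, IsTIdeal (Y i : FractionalIdeal R⁰ K) := fun i => by
    rw [hY]
    exact ⟨vClosure_ne_zero (coeIdeal_ne_zero.2 (hC0 i)), tClosure_vClosure _⟩
  have hYprime : ∀ i, ∀ Q ∈ (Y i).minimalPrimes, Q = P i := by
    intro i Q hQ
    have := hQ.1.1
    obtain ⟨Q', hQ', hQ'Q⟩ := Ideal.exists_minimalPrimes_le ((hXY i).trans hQ.1.2)
    obtain ⟨j, rfl⟩ := hPrange.symm ▸ hQ'
    obtain rfl | hij := eq_or_ne i j
    · exact le_antisymm (hQ.2 ⟨(hPmin i).1.1, hYP i⟩ hQ'Q) hQ'Q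
    · have h1 : (1 : FractionalIdeal R⁰ K) ≤ Q := by
        refine le_trans (hCcop i j hij) ?_
        rw [← coeIdeal_sup]
        exact vClosure_le_of_mem_minimalPrimes (hYt i).2 hQ
          (Submodule.FG.sup (hCfg i) (hCfg j))
          (sup_le ((hCY i).trans hQ.1.2) ((hCP j).trans hQ'Q))
      rw [← coeIdeal_top, coeIdeal_le_coeIdeal K, top_le_iff] at h1
      exact (this.ne_top h1).elim
  refine ⟨n, Y, fun i => ⟨hYt i, ?_, P i, ?_, hYprime i⟩, le_antisymm ?_ ?_⟩
  · rw [hY]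
    exact (hR _ (hC0 i) (hCfg i)).vClosure
  -- Some minimal prime of `Y i` lies below `P i`, and it can only be `P i`.
  · obtain ⟨Q, hQ, -⟩ := @Ideal.exists_minimalPrimes_le _ _ _ _ (hPmin i).1.1 (hYP i)
    exact hYprime i Q hQ ▸ hQ
  · have hprod : (∏ i, (C i : FractionalIdeal R⁰ K)) =
        ((∏ i, C i : Ideal R) : FractionalIdeal R⁰ K) :=
      (map_prod (coeIdealHom R⁰ K) C Finset.univ).symm
    have hCprodfg : (∏ i, C i).FG :=
      Ideal.fg_finset_prod Finset.univ fun i _ => hCfg i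
    have hle := le_vClosure_prod_of_pairwise Finset.univ (I := fun i => (C i : FractionalIdeal R⁰ K))
      (F := F) (fun _ _ => coeIdeal_le_one) coeIdeal_le_one
      (fun i _ => (coeIdeal_le_coeIdeal K).2 le_sup_left) fun i _ j _ => hCcop i j
    rw [← hFv]
    refine (vClosure_le_vClosure_of_le hle).trans (vClosure_le_tClosure ?_ ?_)
    · rw [hprod]
      exact fg_coeIdeal_iff.2 hCprodfg
    · exact Finset.prod_le_prod' fun i _ => (coeIdeal_le_coeIdeal K).2 (hCY i)
  · refine (tClosure_le_vClosure _).trans ?_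
    rw [← hFv]
    refine vClosure_le_vClosure_of_le ((prod_le_vClosure_prod Finset.univ
      fun i _ => (hY i).le).trans (vClosure_le_vClosure_of_le ?_))
    have hBX : ∏ i, ((A i ^ m : Ideal R) : FractionalIdeal R⁰ K) ≤ X := by
      rw [← Finset.prod_pow] at hm
      refine le_trans (le_of_eq ?_) ((coeIdeal_le_coeIdeal K).2 hm)
      exact (map_prod (coeIdealHom R⁰ K) _ Finset.univ).symm
    simp only [C, coeIdeal_sup]
    refine (prod_add_le_add_prod Finset.univ (fun _ _ => coeIdeal_le_one)
      coeIdeal_le_one).trans ?_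
    rw [hFv, ← sup_eq_add]
    exact sup_le ((coeIdeal_le_coeIdeal K).2 hFX) hBX

end Packets

theorem theoremB {R : Type*} [CommRing R] [IsDomain R] {K : Type*} [Field K] [Algebra R K]
    [IsFractionRing R K] (hR : IsPVMD R K) (X : Ideal R) (hX : X ≠ ⊤)
    (hXt : FractionalIdeal.IsTIdeal (X : FractionalIdeal R⁰ K))
    (hXinv : FractionalIdeal.IsTInvertible (X : FractionalIdeal R⁰ K)) :
    IsTProductOfPackets K X ↔ X.minimalPrimes.Finite :=
  ⟨fun h => h.finite_minimalPrimes, hR.isTProductOfPackets hXt hXinv⟩
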